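/- Let $n \ge 2$ and let $B=[b_1,\dots,b_n]$ be a basis of a full-rank lattice $\mathcal{L}\subset\mathbb{R}^n$, with (unnormalised) Gram--Schmidt vectors $b_1^*,\dots,b_n^*$. Assume that $B$ is dual HKZ-reduced: its reverse dual basis $[d_1,\dots,d_n]$, defined by $\langle d_i,b_j\rangle=\delta_{i,n-j+1}$, is HKZ-reduced, i.e. (1) $\langle d_i,d_j^*\rangle/\langle d_j^*,d_j^*\rangle\le\frac12$ for all $j<i$ (this holds in particular if the absolute value of the quotient is at most $\frac12$), and (2) for every $i$, $\|d_i^*\|=\lambda_1(\pi_i(\mathcal{L}(d_1,\dots,d_n)))$ is the length of a shortest nonzero vector of the orthogonal projection of the lattice $\mathcal{L}(d_1,\dots,d_n)$ onto $\mathrm{span}(d_1,\dots,d_{i-1})^{\perp}$. For $1\le i\le n$ let $\mu^{(i)}$ be the covering radius of $\mathcal{L}(b_1,\dots,b_i)$, that is, $\mu^{(i)}=\max_{t\in\mathrm{span}(b_1,\dots,b_i)}\ \min_{x\in\mathcal{L}(b_1,\dots,b_i)}\|x-t\|$, and for an integer $i\ge 2$ and $c\in\mathbb{R}$ put $$A_i^2(c)=\frac{\frac{i^2}{4}-c^2}{\frac{i^2}{4}-\frac14}.$$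 Then for every $i\in\{2,\dots,n\}$: (a) For every $c\in\mathbb{R}$ with $c^2\ge\frac14$, $$(\mu^{(i)})^2-c^2\|b_i^*\|^2\le A_i^2(c)\,(\mu^{(i-1)})^2 .$$ (b) Let $t\in\mathbb{R}^n$, let $v\in\mathcal{L}$ be a closest lattice vector to $t$ (that is, $\|v-t\|\le\|w-t\|$ for all $w\in\mathcal{L}$), write $e=t-v=e_1b_1^*+\dots+e_nb_n^*$ with $e_j\in\mathbb{R}$, and let $e^{(i-1)}=e-\sum_{j=i}^{n}e_jb_j^*$, the orthogonal projection of $e$ onto $\mathrm{span}(b_1,\dots,b_{i-1})$. Then $$\|e^{(i-1)}\|^2\le A_i^2(e_i)\,(\mu^{(i-1)})^2 .$$ -/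

import Mathlib

noncomputable section

/-- The lattice of all integer linear combinations of the vectors `b j`. -/
def latticeOf {m k : ℕ} (b : Fin k → EuclideanSpace ℝ (Fin m)) :
    Submodule ℤ (EuclideanSpace ℝ (Fin m)) :=
  Submodule.span ℤ (Set.range b)

/-- `L(b_1, …, b_i)`: the lattice generated by the first `i` vectors of the family. -/
def initialLattice {m k : ℕ} (b : Fin k → EuclideanSpace ℝ (Fin m)) (i : ℕ) :
    Submodule ℤ (EuclideanSpace ℝ (Fin m)) :=
  Submodule.span ℤ (b '' {j | (j : ℕ) < i})

/-- The covering radius of a lattice: the largest distance to the lattice of a point of its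
real span. -/
def coveringRadius {m : ℕ} (L : Submodule ℤ (EuclideanSpace ℝ (Fin m))) : ℝ :=
  sSup ((fun t => Metric.infDist t (L : Set (EuclideanSpace ℝ (Fin m)))) ''
    (Submodule.span ℝ (L : Set (EuclideanSpace ℝ (Fin m))) : Set (EuclideanSpace ℝ (Fin m))))

/-- The first minimum of a lattice: the length of a shortest nonzero lattice vector. -/
def firstMinimum {m : ℕ} (L : Submodule ℤ (EuclideanSpace ℝ (Fin m))) : ℝ :=
  sInf {r | ∃ v ∈ L, v ≠ 0 ∧ r = ‖v‖}

/-- The Gram-Schmidt family `b*` of `b`, without normalisation. -/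
def gsVec {m k : ℕ} (b : Fin k → EuclideanSpace ℝ (Fin m)) :
    Fin k → EuclideanSpace ℝ (Fin m) :=
  InnerProductSpace.gramSchmidt ℝ b

/-- The image of the lattice generated by `b` under the orthogonal projection onto the orthogonal
complement of the span of the vectors preceding `b i`. -/
def projectedLattice {m k : ℕ} (b : Fin k → EuclideanSpace ℝ (Fin m)) (i : Fin k) :
    Submodule ℤ (EuclideanSpace ℝ (Fin m)) :=
  (latticeOf b).map
    (((Submodule.span ℝ (b '' {j | j < i}))ᗮ.starProjection :
      EuclideanSpace ℝ (Fin m) →ₗ[ℝ] EuclideanSpace ℝ (Fin m)).restrictScalars ℤ)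

/-- HKZ-reducedness of a lattice basis `b` (a linearly independent family). The first condition is
one-sided; it is implied by the two-sided condition with an absolute value, so a basis that is
HKZ-reduced in the two-sided sense satisfies this predicate. -/
structure IsHKZ {m k : ℕ} (b : Fin k → EuclideanSpace ℝ (Fin m)) : Prop where
  size_reduced : ∀ i j : Fin k, j < i →
    inner ℝ (b i) (gsVec b j) / inner ℝ (gsVec b j) (gsVec b j) ≤ (1 / 2 : ℝ)
  norm_gsVec : ∀ i : Fin k, ‖gsVec b i‖ = firstMinimum (projectedLattice b i)

/-- `d` is the reverse dual basis of `b`: its vectors lie in the span of `b`, and with indices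
running over `1, …, k`, `⟨d_i, b_j⟩` is `1` if `i = k - j + 1` and `0` otherwise. -/
structure IsReverseDual {m k : ℕ} (b d : Fin k → EuclideanSpace ℝ (Fin m)) : Prop where
  mem_span : ∀ i : Fin k, d i ∈ Submodule.span ℝ (Set.range b)
  inner_eq : ∀ i j : Fin k, inner ℝ (d i) (b j) = if i = Fin.rev j then (1 : ℝ) else 0

/-- A basis is dual HKZ if its reverse dual basis is HKZ-reduced. -/
def IsDualHKZ {m k : ℕ} (b : Fin k → EuclideanSpace ℝ (Fin m)) : Prop :=
  ∃ d : Fin k → EuclideanSpace ℝ (Fin m), IsReverseDual b d ∧ IsHKZ d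

/-- `v` is a closest vector of the lattice `L` to `t`. -/
def IsClosestVector {m : ℕ} (L : Submodule ℤ (EuclideanSpace ℝ (Fin m)))
    (t v : EuclideanSpace ℝ (Fin m)) : Prop :=
  v ∈ L ∧ ∀ w ∈ L, ‖v - t‖ ≤ ‖w - t‖

/-- For an error vector `err` with coefficients `e` in the Gram-Schmidt basis:
`err^(i) = err - ∑_{j > i} e_j b*_j`, where `j` runs over `1, …, k`. (An element `j : Fin k` stands
for the index `j + 1`.) -/
def partialError {m k : ℕ} (b : Fin k → EuclideanSpace ℝ (Fin m))
    (err : EuclideanSpace ℝ (Fin m)) (e : Fin k → ℝ) (i : ℕ) : EuclideanSpace ℝ (Fin m) :=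
  err - ∑ j ∈ Finset.univ.filter (fun j : Fin k => i < (j : ℕ) + 1), e j • gsVec b j

/-- `A_i²(c) = (i²/4 - c²) / (i²/4 - 1/4)`. -/
def Asq (i : ℕ) (c : ℝ) : ℝ :=
  ((i : ℝ) ^ 2 / 4 - c ^ 2) / ((i : ℝ) ^ 2 / 4 - 1 / 4)

end

open MeasureTheory Real Set Filter Topology

/-! Write β_i = ‖b_i^*‖. Rounding the last Gram–Schmidt coordinate gives (μ^(i))² ≤ (μ^(i-1))² +
β_i²/4 (`coveringRadius_succ_sq_le`). Since A_i²(c) = 1 - (c² - 1/4)/(i²/4 - 1/4), part (a) follows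
from (μ^(i-1))² ≤ (i²/4 - 1/4) β_i² (`HasLongDuals.coveringRadius_sq_le`).

Dual HKZ reduction is used through one consequence, `HasLongDuals`: every nonzero vector of the dual
of L(b_1, …, b_i) has length at least 1/β_i. It implies β_{i-1}² ≤ (4/3) β_i², and a geometric sum
then settles ranks i - 1 ≤ 7. For rank m ≥ 8 a transference bound μ ≤ m/(π λ_1^*) is needed
(`exists_norm_sq_le`); it comes from Poisson summation for Gaussian sums, in the manner of
Banaszczyk.

For (b), e^(k) is never longer than μ^(k) (`norm_partialError_le`). If e_i² ≤ 1/4, then A_i²(e_i) ≥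
1 and this suffices; otherwise ‖e^(i-1)‖² = ‖e^(i)‖² - e_i² β_i², and (a) applies with c = e_i. -/

/-! ### Summability of Gaussians over ℤ^ι. -/

theorem summable_exp_neg_mul_int_sq {c : ℝ} (hc : 0 < c) :
    Summable fun k : ℤ => rexp (-c * (k : ℝ) ^ 2) := by
  have h : Summable fun k : ℕ => rexp (-c * (k : ℝ) ^ 2) := by
    refine Summable.of_nonneg_of_le (fun _ => (exp_pos _).le) (fun k => ?_)
      (Real.summable_pow_mul_exp_neg_nat_mul 0 hc)
    rw [pow_zero, one_mul]
    refine exp_le_exp.2 ?_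
    have : (k : ℝ) ≤ (k : ℝ) ^ 2 := by exact_mod_cast Nat.le_self_pow two_ne_zero k
    nlinarith
  refine Summable.of_nat_of_neg ?_ ?_ <;> simpa using h

theorem summable_prod_pi {ι κ : Type*} [Fintype ι] [DecidableEq ι] {f : κ → ℝ}
    (hf : Summable f) (h0 : ∀ k, 0 ≤ f k) :
    Summable fun k : ι → κ => ∏ i, f (k i) := by
  classical
  refine summable_of_sum_le (c := ∏ _i : ι, ∑' a, f a)
    (fun k => Finset.prod_nonneg fun i _ => h0 _) fun s => ?_
  calc ∑ k ∈ s, ∏ i, f (k i)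
      ≤ ∑ k ∈ Fintype.piFinset (fun i => s.image (fun k => k i)), ∏ i, f (k i) := by
        refine Finset.sum_le_sum_of_subset_of_nonneg (fun k hk => ?_)
          fun k _ _ => Finset.prod_nonneg fun i _ => h0 _
        exact Fintype.mem_piFinset.2 fun i => Finset.mem_image_of_mem _ hk
    _ = ∏ i, ∑ a ∈ s.image (fun k => k i), f a := (Finset.prod_univ_sum _ _).symm
    _ ≤ _ := Finset.prod_le_prod (fun i _ => Finset.sum_nonneg fun a _ => h0 a)
        fun i _ => hf.sum_le_tsum _ fun a _ => h0 a

theorem summable_exp_neg_of_le {ι : Type*} [Fintype ι] {c : ℝ} (hc : 0 < c)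
    {q : (ι → ℤ) → ℝ} (hq : ∀ k, c * ∑ i, (k i : ℝ) ^ 2 ≤ q k) :
    Summable fun k => rexp (-q k) := by
  classical
  refine Summable.of_nonneg_of_le (fun _ => (exp_pos _).le) (fun k => ?_)
    (summable_prod_pi (ι := ι) (summable_exp_neg_mul_int_sq hc) fun _ => (exp_pos _).le)
  rw [← Real.exp_sum, ← Finset.mul_sum]
  refine exp_le_exp.2 ?_
  linarith [hq k]

/-! ### Gaussian sums over a lattice as functions on the torus. -/

section Theta

variable {ι : Type*} [Fintype ι] {E : Type*} [NormedAddCommGroup E] [InnerProductSpace ℝ E]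
  [FiniteDimensional ℝ E]

/-- The real vector with the given integer coordinates. -/
def intVec (k : ι → ℤ) : ι → ℝ := fun i => k i

/-- The periodic Gaussian sum attached to the lattice `B (ℤ^ι)`. -/
noncomputable def thetaSum (B : (ι → ℝ) ≃L[ℝ] E) (a : ℝ) (x : ι → ℝ) : ℝ :=
  ∑' k : ι → ℤ, rexp (-(a * ‖B (x + intVec k)‖ ^ 2))

/-- The vector of `E` whose inner product with `B x` is `∑ i, j i * x i`. -/
noncomputable def dualVec (B : (ι → ℝ) ≃L[ℝ] E) (j : ι → ℤ) : E :=
  (InnerProductSpace.toDual ℝ E).symm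
    ((LinearMap.toContinuousLinearMap
      (∑ i, (j i : ℝ) • LinearMap.proj (R := ℝ) (φ := fun _ : ι => ℝ) i)).comp
        (B.symm : E →L[ℝ] ι → ℝ))

theorem inner_dualVec (B : (ι → ℝ) ≃L[ℝ] E) (j : ι → ℤ) (x : ι → ℝ) :
    inner ℝ (dualVec B j) (B x) = ∑ i, (j i : ℝ) * x i := by
  simp [dualVec, InnerProductSpace.toDual_symm_apply]

omit [FiniteDimensional ℝ E] in
theorem exists_le_norm_sq (B : (ι → ℝ) ≃L[ℝ] E) :
    ∃ κ > 0, ∀ x : ι → ℝ, κ * ∑ i, x i ^ 2 ≤ ‖B x‖ ^ 2 := by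
  obtain ⟨K, hK, hB⟩ := B.symm.toContinuousLinearMap.bound
  refine ⟨1 / (K ^ 2 * (Fintype.card ι + 1)), by positivity, fun x => ?_⟩
  have h1 : ‖x‖ ≤ K * ‖B x‖ := by simpa using hB (B x)
  have h2 : ∑ i, x i ^ 2 ≤ (Fintype.card ι + 1) * ‖x‖ ^ 2 := by
    calc ∑ i, x i ^ 2 ≤ ∑ _i : ι, ‖x‖ ^ 2 := Finset.sum_le_sum fun i _ => by
          rw [← sq_abs]; exact pow_le_pow_left₀ (abs_nonneg _) (norm_le_pi_norm x i) 2
      _ ≤ _ := by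
        rw [Finset.sum_const, nsmul_eq_mul, Finset.card_univ]
        nlinarith [sq_nonneg ‖x‖]
  have h3 : ‖x‖ ^ 2 ≤ K ^ 2 * ‖B x‖ ^ 2 := by
    rw [← mul_pow]; exact pow_le_pow_left₀ (norm_nonneg _) h1 2
  rw [div_mul_eq_mul_div, one_mul, div_le_iff₀ (by positivity)]
  have h4 := mul_le_mul_of_nonneg_left h3 (by positivity : (0 : ℝ) ≤ Fintype.card ι + 1)
  linarith

theorem exists_le_norm_dualVec_sq (B : (ι → ℝ) ≃L[ℝ] E) :
    ∃ κ > 0, ∀ j : ι → ℤ, κ * ∑ i, (j i : ℝ) ^ 2 ≤ ‖dualVec B j‖ ^ 2 := by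
  classical
  refine ⟨1 / (1 + ∑ i, ‖B (Pi.single i 1)‖ ^ 2), by positivity, fun j => ?_⟩
  have h : ∀ i, (j i : ℝ) ^ 2 ≤ ‖dualVec B j‖ ^ 2 * ‖B (Pi.single i 1)‖ ^ 2 := fun i => by
    have h1 := abs_real_inner_le_norm (dualVec B j) (B (Pi.single i 1))
    have h2 : inner ℝ (dualVec B j) (B (Pi.single i 1)) = (j i : ℝ) := by
      rw [inner_dualVec]; simp [Pi.single_apply]
    rw [h2] at h1
    rw [← mul_pow, ← sq_abs]
    exact pow_le_pow_left₀ (abs_nonneg _) h1 2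
  have h3 := Finset.sum_le_sum fun i (_ : i ∈ Finset.univ) => h i
  rw [← Finset.mul_sum] at h3
  rw [div_mul_eq_mul_div, one_mul, div_le_iff₀ (by positivity)]
  nlinarith [sq_nonneg ‖dualVec B j‖]

omit [FiniteDimensional ℝ E] in
theorem summable_exp_neg_norm_sq (B : (ι → ℝ) ≃L[ℝ] E) {a : ℝ} (ha : 0 < a) :
    Summable fun k : ι → ℤ => rexp (-(a * ‖B (intVec k)‖ ^ 2)) := by
  obtain ⟨κ, hκ, h⟩ := exists_le_norm_sq B
  refine summable_exp_neg_of_le (mul_pos ha hκ) fun k => ?_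
  rw [mul_assoc]
  exact mul_le_mul_of_nonneg_left (h (intVec k)) ha.le

theorem summable_exp_neg_norm_dualVec_sq (B : (ι → ℝ) ≃L[ℝ] E) {a : ℝ} (ha : 0 < a) :
    Summable fun j : ι → ℤ => rexp (-(a * ‖dualVec B j‖ ^ 2)) := by
  obtain ⟨κ, hκ, h⟩ := exists_le_norm_dualVec_sq B
  refine summable_exp_neg_of_le (mul_pos ha hκ) fun k => ?_
  rw [mul_assoc]
  exact mul_le_mul_of_nonneg_left (h k) ha.le

-- Comes from ‖By‖² ≤ 2(‖B(x + y)‖² + ‖Bx‖²). The extra factor in x makes the majorant independent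
-- of x, so the M-test proves continuity on all of ℝ^ι at once.
omit [Fintype ι] [FiniteDimensional ℝ E] in
theorem exp_neg_norm_add_sq_le (B : (ι → ℝ) ≃L[ℝ] E) {a : ℝ} (ha : 0 < a) (x y : ι → ℝ) :
    rexp (-(a * ‖B x‖ ^ 2)) * rexp (-(a * ‖B (x + y)‖ ^ 2)) ≤ rexp (-(a / 2 * ‖B y‖ ^ 2)) := by
  rw [← exp_add]
  refine exp_le_exp.2 ?_
  have h : ‖B y‖ ≤ ‖B (x + y)‖ + ‖B x‖ := by
    have := norm_sub_le (B (x + y)) (B x)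
    simpa using this
  have h2 : ‖B y‖ ^ 2 ≤ (‖B (x + y)‖ + ‖B x‖) ^ 2 := pow_le_pow_left₀ (norm_nonneg _) h 2
  have h3 : ‖B y‖ ^ 2 ≤ 2 * (‖B (x + y)‖ ^ 2 + ‖B x‖ ^ 2) := by
    nlinarith [sq_nonneg (‖B (x + y)‖ - ‖B x‖)]
  nlinarith

omit [FiniteDimensional ℝ E] in
theorem summable_thetaSum (B : (ι → ℝ) ≃L[ℝ] E) {a : ℝ} (ha : 0 < a) (x : ι → ℝ) :
    Summable fun k : ι → ℤ => rexp (-(a * ‖B (x + intVec k)‖ ^ 2)) := by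
  have h := Summable.of_nonneg_of_le (fun k => by positivity)
    (fun k => exp_neg_norm_add_sq_le B ha x (intVec k))
    (summable_exp_neg_norm_sq B (half_pos ha))
  exact (summable_mul_left_iff (exp_pos _).ne').1 h

omit [FiniteDimensional ℝ E] in
theorem continuous_thetaSum (B : (ι → ℝ) ≃L[ℝ] E) {a : ℝ} (ha : 0 < a) :
    Continuous (thetaSum B a) := by
  have h : thetaSum B a = fun x => rexp (a * ‖B x‖ ^ 2) *
      ∑' k : ι → ℤ, rexp (-(a * ‖B x‖ ^ 2)) * rexp (-(a * ‖B (x + intVec k)‖ ^ 2)) := by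
    funext x
    rw [tsum_mul_left, ← mul_assoc, ← exp_add, add_neg_cancel, exp_zero, one_mul, thetaSum]
  rw [h]
  refine Continuous.mul (by fun_prop) (continuous_tsum (fun k => by fun_prop)
    (summable_exp_neg_norm_sq B (half_pos ha)) fun k x => ?_)
  rw [norm_of_nonneg (by positivity)]
  exact exp_neg_norm_add_sq_le B ha x (intVec k)

omit [Fintype ι] [FiniteDimensional ℝ E] in
theorem thetaSum_add_intVec (B : (ι → ℝ) ≃L[ℝ] E) (a : ℝ) (x : ι → ℝ) (l : ι → ℤ) :
    thetaSum B a (x + intVec l) = thetaSum B a x := by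
  rw [thetaSum, thetaSum,
    ← (Equiv.addLeft l).tsum_eq fun k => rexp (-(a * ‖B (x + intVec k)‖ ^ 2))]
  refine tsum_congr fun k => ?_
  have : x + intVec (Equiv.addLeft l k) = x + intVec l + intVec k := by
    ext i; simp [intVec, add_assoc]
  rw [this]

/-- The projection of `ℝ^ι` onto the torus. -/
def toTorus (x : ι → ℝ) : UnitAddTorus ι := fun i => (x i : UnitAddCircle)

omit [Fintype ι] in
theorem isOpenQuotientMap_toTorus : IsOpenQuotientMap (toTorus (ι := ι)) :=
  IsOpenQuotientMap.piMap fun _ => QuotientAddGroup.isOpenQuotientMap_mk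

omit [Fintype ι] in
theorem exists_intVec_of_toTorus_eq {x y : ι → ℝ} (h : toTorus x = toTorus y) :
    ∃ l : ι → ℤ, x = y + intVec l := by
  have h1 : ∀ i, ∃ l : ℤ, x i = y i + l := fun i => by
    have h2 : (y i : UnitAddCircle) = x i := (congrFun h i).symm
    rw [QuotientAddGroup.eq] at h2
    obtain ⟨l, hl⟩ := AddSubgroup.mem_zmultiples_iff.1 h2
    refine ⟨l, ?_⟩
    simp at hl
    linarith
  choose l hl using h1
  exact ⟨l, funext hl⟩

/-- The Gaussian sum as a continuous function on the torus. -/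
noncomputable def thetaTorus (B : (ι → ℝ) ≃L[ℝ] E) {a : ℝ} (ha : 0 < a) :
    C(UnitAddTorus ι, ℂ) :=
  (isOpenQuotientMap_toTorus.isQuotientMap).lift (f := ⟨toTorus, isOpenQuotientMap_toTorus.continuous⟩)
    ⟨fun x => (thetaSum B a x : ℂ), Complex.continuous_ofReal.comp (continuous_thetaSum B ha)⟩
    fun x y h => by
      obtain ⟨l, rfl⟩ := exists_intVec_of_toTorus_eq h
      simp [thetaSum_add_intVec]

omit [FiniteDimensional ℝ E] in
theorem thetaTorus_toTorus (B : (ι → ℝ) ≃L[ℝ] E) {a : ℝ} (ha : 0 < a) (x : ι → ℝ) :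
    thetaTorus B ha (toTorus x) = thetaSum B a x := by
  have := (isOpenQuotientMap_toTorus (ι := ι)).isQuotientMap.lift_comp
    (f := ⟨toTorus, isOpenQuotientMap_toTorus.continuous⟩)
    ⟨fun x => (thetaSum B a x : ℂ), Complex.continuous_ofReal.comp (continuous_thetaSum B ha)⟩
    fun x y h => by
      obtain ⟨l, rfl⟩ := exists_intVec_of_toTorus_eq h
      simp [thetaSum_add_intVec]
  exact DFunLike.congr_fun this x

theorem mFourier_toTorus (j : ι → ℤ) (x : ι → ℝ) :
    UnitAddTorus.mFourier j (toTorus x) =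
      Complex.exp (2 * π * Complex.I * (∑ i, (j i : ℝ) * x i : ℝ)) := by
  simp only [UnitAddTorus.mFourier, ContinuousMap.coe_mk, toTorus, fourier_coe_apply]
  rw [← Complex.exp_sum]
  congr 1
  push_cast
  rw [Finset.mul_sum]
  exact Finset.sum_congr rfl fun i _ => by ring

theorem mFourier_toTorus_add_intVec (j l : ι → ℤ) (x : ι → ℝ) :
    UnitAddTorus.mFourier j (toTorus (x + intVec l)) =
      UnitAddTorus.mFourier j (toTorus x) := by
  congr 1
  ext i
  simp [toTorus, intVec]

end Theta

/-! ### Poisson summation for Gaussian sums. -/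

section Poisson

variable {ι : Type*} [Fintype ι] {E : Type*} [NormedAddCommGroup E] [InnerProductSpace ℝ E]
  [FiniteDimensional ℝ E] [MeasurableSpace E] [BorelSpace E]

/-- The factor by which `B` transports Lebesgue measure to the volume of `E`. -/
noncomputable def volumeFactor (B : (ι → ℝ) ≃L[ℝ] E) : NNReal :=
  Measure.addHaarScalarFactor ((volume : Measure (ι → ℝ)).map B) (volume : Measure E)

theorem volumeFactor_pos (B : (ι → ℝ) ≃L[ℝ] E) : 0 < volumeFactor B :=
  Measure.addHaarScalarFactor_pos_of_isAddHaarMeasure _ _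

theorem map_volume_eq (B : (ι → ℝ) ≃L[ℝ] E) :
    (volume : Measure (ι → ℝ)).map B = volumeFactor B • (volume : Measure E) :=
  Measure.isAddLeftInvariant_eq_smul _ _

theorem integral_comp_equiv (B : (ι → ℝ) ≃L[ℝ] E) (f : E → ℂ) :
    ∫ x, f (B x) = (volumeFactor B : ℝ) * ∫ v, f v := by
  have h := (B.toHomeomorph.toMeasurableEquiv).measurableEmbedding.integral_map
    (μ := (volume : Measure (ι → ℝ))) f
  change ∫ y, f y ∂((volume : Measure (ι → ℝ)).map B) = ∫ x, f (B x) at h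
  rw [← h, map_volume_eq, integral_smul_nnreal_measure, NNReal.smul_def, Complex.real_smul]

theorem integrable_comp_equiv (B : (ι → ℝ) ≃L[ℝ] E) {f : E → ℂ} (hf : Integrable f) :
    Integrable fun x => f (B x) := by
  have h := integrable_map_equiv (μ := (volume : Measure (ι → ℝ)))
    (B.toHomeomorph.toMeasurableEquiv) f
  change Integrable f ((volume : Measure (ι → ℝ)).map B) ↔ Integrable (fun x => f (B x)) at h
  rw [← h, map_volume_eq]
  exact hf.smul_measure_nnreal

/-- The Gaussian on `ℝ^ι` attached to `B`, multiplied by a character. -/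
noncomputable def charGaussian (B : (ι → ℝ) ≃L[ℝ] E) (a : ℝ) (j : ι → ℤ) (x : ι → ℝ) : ℂ :=
  UnitAddTorus.mFourier (-j) (toTorus x) * (rexp (-(a * ‖B x‖ ^ 2)) : ℝ)

omit [MeasurableSpace E] [BorelSpace E] in
theorem charGaussian_eq (B : (ι → ℝ) ≃L[ℝ] E) (a : ℝ) (j : ι → ℤ) (x : ι → ℝ) :
    charGaussian B a j x = Complex.exp (-(a : ℂ) * ‖B x‖ ^ 2 +
      (-(2 * π * Complex.I)) * (inner ℝ (dualVec B j) (B x) : ℝ)) := by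
  rw [charGaussian, mFourier_toTorus, inner_dualVec, Complex.ofReal_exp, ← Complex.exp_add]
  congr 1
  push_cast
  simp only [Pi.neg_apply, Int.cast_neg, neg_mul, Finset.sum_neg_distrib]
  ring

theorem integrable_charGaussian (B : (ι → ℝ) ≃L[ℝ] E) {a : ℝ} (ha : 0 < a) (j : ι → ℤ) :
    Integrable (charGaussian B a j) := by
  have h := integrable_comp_equiv B (GaussianFourier.integrable_cexp_neg_mul_sq_norm_add
    (b := (a : ℂ)) (by simpa using ha) (-(2 * π * Complex.I)) (dualVec B j))
  refine h.congr (Eventually.of_forall fun x => ?_)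
  exact (charGaussian_eq B a j x).symm

theorem integral_charGaussian (B : (ι → ℝ) ≃L[ℝ] E) {a : ℝ} (ha : 0 < a) (j : ι → ℤ) :
    ∫ x, charGaussian B a j x =
      ((volumeFactor B * (π / a) ^ (Module.finrank ℝ E / 2 : ℝ) *
        rexp (-(π ^ 2 / a * ‖dualVec B j‖ ^ 2)) : ℝ) : ℂ) := by
  have h1 : (fun x => charGaussian B a j x) = fun x =>
      (fun v : E => Complex.exp (-(a : ℂ) * ‖v‖ ^ 2 +
      (-(2 * π * Complex.I)) * (inner ℝ (dualVec B j) v : ℝ))) (B x) :=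
    funext fun x => charGaussian_eq B a j x
  have ha' : (a : ℂ) ≠ 0 := by exact_mod_cast ha.ne'
  rw [h1, integral_comp_equiv B (fun v : E => Complex.exp (-(a : ℂ) * ‖v‖ ^ 2 +
      (-(2 * π * Complex.I)) * (inner ℝ (dualVec B j) v : ℝ))), GaussianFourier.integral_cexp_neg_mul_sq_norm_add
    (by simpa using ha)]
  push_cast
  rw [Complex.ofReal_cpow (by positivity)]
  push_cast
  rw [← mul_assoc]
  congr 2
  field_simp
  rw [Complex.I_sq]
  ring

/-- Half-open unit boxes with integral corners. -/
def unitBox (k : ι → ℤ) : Set (ι → ℝ) := {x | ∀ i, x i ∈ Ioc (k i : ℝ) (k i + 1)}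

theorem measurableSet_unitBox (k : ι → ℤ) : MeasurableSet (unitBox k) :=
  MeasurableSet.univ_pi' (fun _ => measurableSet_Ioc)

omit [Fintype ι] in
theorem mem_unitBox_iff {k : ι → ℤ} {x : ι → ℝ} :
    x ∈ unitBox k ↔ ∀ i, k i = ⌈x i⌉ - 1 := by
  refine forall_congr' fun i => ?_
  rw [mem_Ioc, eq_sub_iff_add_eq, eq_comm, Int.ceil_eq_iff]
  push_cast
  rw [add_sub_cancel_right]

omit [Fintype ι] in
theorem pairwise_disjoint_unitBox : Pairwise (Function.onFun Disjoint (unitBox (ι := ι))) :=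
  fun k l hkl => Set.disjoint_left.2 fun x hk hl => hkl <| funext fun i => by
    rw [mem_unitBox_iff.1 hk i, mem_unitBox_iff.1 hl i]

omit [Fintype ι] in
theorem iUnion_unitBox : ⋃ k, unitBox (ι := ι) k = univ :=
  eq_univ_of_forall fun x => mem_iUnion.2 ⟨fun i => ⌈x i⌉ - 1, mem_unitBox_iff.2 fun _ => rfl⟩

theorem setIntegral_unitBox {F : Type*} [NormedAddCommGroup F] [NormedSpace ℝ F]
    (f : (ι → ℝ) → F) (k : ι → ℤ) :
    ∫ x in unitBox 0, f (x + intVec k) = ∫ x in unitBox k, f x := by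
  rw [← (measurePreserving_add_right volume (intVec k)).setIntegral_preimage_emb
    (measurableEmbedding_addRight (intVec k)) f (unitBox k)]
  congr 2
  ext x
  simp only [unitBox, intVec, mem_ofPred_eq, mem_preimage, Pi.add_apply, mem_Ioc, Pi.zero_apply,
    Int.cast_zero, zero_add, add_comm (x _), add_le_add_iff_left,
    lt_add_iff_pos_right]

theorem integrableOn_unitBox {F : Type*} [NormedAddCommGroup F]
    {f : (ι → ℝ) → F} (hf : Integrable f) (k : ι → ℤ) :
    IntegrableOn (fun x => f (x + intVec k)) (unitBox 0) :=
  (hf.comp_add_right (intVec k)).integrableOn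

theorem hasSum_setIntegral_unitBox {F : Type*} [NormedAddCommGroup F] [NormedSpace ℝ F]
    {f : (ι → ℝ) → F} (hf : Integrable f) :
    HasSum (fun k => ∫ x in unitBox 0, f (x + intVec k)) (∫ x, f x) := by
  have h := hasSum_integral_iUnion (f := f) (μ := volume)
    (measurableSet_unitBox (ι := ι)) pairwise_disjoint_unitBox hf.integrableOn
  simpa only [setIntegral_unitBox, iUnion_unitBox, Measure.restrict_univ] using h

/-- Unfolding: the integer translates of the unit box tile ℝ^ι. -/
theorem setIntegral_tsum_add_intVec {f : (ι → ℝ) → ℂ} (hf : Integrable f) :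
    ∫ x in unitBox 0, ∑' k, f (x + intVec k) = ∫ x, f x := by
  have h := hasSum_integral_of_summable_integral_norm (μ := volume.restrict (unitBox 0))
    (F := fun (k : ι → ℤ) x => f (x + intVec k)) (fun k => integrableOn_unitBox hf k)
    (hasSum_setIntegral_unitBox hf.norm).summable
  exact h.unique (hasSum_setIntegral_unitBox hf)

omit [FiniteDimensional ℝ E] [MeasurableSpace E] [BorelSpace E] in
theorem tsum_charGaussian (B : (ι → ℝ) ≃L[ℝ] E) (a : ℝ) (j : ι → ℤ) (x : ι → ℝ) :
    ∑' k, charGaussian B a j (x + intVec k) =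
      UnitAddTorus.mFourier (-j) (toTorus x) * thetaSum B a x := by
  simp only [charGaussian, mFourier_toTorus_add_intVec]
  rw [tsum_mul_left, ← Complex.ofReal_tsum, thetaSum]

/-- A character is invariant under integer translations, so unfolding turns the coefficient into the
Fourier transform of one Gaussian. These coefficients are positive, which drives all later
estimates. -/
theorem mFourierCoeff_thetaTorus (B : (ι → ℝ) ≃L[ℝ] E) {a : ℝ} (ha : 0 < a) (j : ι → ℤ) :
    UnitAddTorus.mFourierCoeff (thetaTorus B ha) j =
      ((volumeFactor B * (π / a) ^ (Module.finrank ℝ E / 2 : ℝ) *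
        rexp (-(π ^ 2 / a * ‖dualVec B j‖ ^ 2)) : ℝ) : ℂ) := by
  rw [← integral_charGaussian B ha j, ← setIntegral_tsum_add_intVec (integrable_charGaussian B ha j),
    UnitAddTorus.mFourierCoeff_eq_integral _ _ (0 : ι → ℝ)]
  simp only [tsum_charGaussian, ← thetaTorus_toTorus B ha, smul_eq_mul]
  simp only [unitBox, Pi.zero_apply, Int.cast_zero]
  rfl

/-- The constant term in the Poisson summation formula. -/
noncomputable def poissonFactor (B : (ι → ℝ) ≃L[ℝ] E) (a : ℝ) : ℝ :=
  volumeFactor B * (π / a) ^ (Module.finrank ℝ E / 2 : ℝ)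

/-- The Gaussian sum over the dual lattice. -/
noncomputable def dualSum (B : (ι → ℝ) ≃L[ℝ] E) (a : ℝ) : ℝ :=
  ∑' j : ι → ℤ, rexp (-(π ^ 2 / a * ‖dualVec B j‖ ^ 2))

omit [MeasurableSpace E] [BorelSpace E] in
theorem summable_dualSum (B : (ι → ℝ) ≃L[ℝ] E) {a : ℝ} (ha : 0 < a) :
    Summable fun j : ι → ℤ => rexp (-(π ^ 2 / a * ‖dualVec B j‖ ^ 2)) :=
  summable_exp_neg_norm_dualVec_sq B (by positivity)

theorem hasSum_thetaSum (B : (ι → ℝ) ≃L[ℝ] E) {a : ℝ} (ha : 0 < a) (x : ι → ℝ) :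
    HasSum (fun j : ι → ℤ => ((poissonFactor B a *
        rexp (-(π ^ 2 / a * ‖dualVec B j‖ ^ 2)) : ℝ) : ℂ) *
      UnitAddTorus.mFourier j (toTorus x)) (thetaSum B a x) := by
  have hs : Summable (UnitAddTorus.mFourierCoeff (thetaTorus B ha)) := by
    have h := ((summable_dualSum B ha).mul_left (poissonFactor B a))
    refine (Complex.hasSum_ofReal.2 h.hasSum).summable.congr fun j => ?_
    rw [mFourierCoeff_thetaTorus, poissonFactor]
  have h := UnitAddTorus.hasSum_mFourier_series_apply_of_summable hs (toTorus x)
  rw [thetaTorus_toTorus] at h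
  simpa only [mFourierCoeff_thetaTorus, smul_eq_mul, poissonFactor] using h

theorem poissonFactor_pos (B : (ι → ℝ) ≃L[ℝ] E) {a : ℝ} (ha : 0 < a) : 0 < poissonFactor B a :=
  mul_pos (volumeFactor_pos B) (by positivity)

theorem poissonFactor_half (B : (ι → ℝ) ≃L[ℝ] E) {a : ℝ} (ha : 0 < a) :
    poissonFactor B (a / 2) = 2 ^ (Module.finrank ℝ E / 2 : ℝ) * poissonFactor B a := by
  rw [poissonFactor, poissonFactor, show π / (a / 2) = 2 * (π / a) by field_simp,
    mul_rpow (by positivity) (by positivity)]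
  ring

theorem thetaSum_zero (B : (ι → ℝ) ≃L[ℝ] E) {a : ℝ} (ha : 0 < a) :
    thetaSum B a 0 = poissonFactor B a * dualSum B a := by
  have h := hasSum_thetaSum B ha 0
  have h0 : ∀ j : ι → ℤ, UnitAddTorus.mFourier j (toTorus (0 : ι → ℝ)) = 1 := fun j => by
    rw [mFourier_toTorus]; simp
  simp only [h0, mul_one] at h
  rw [dualSum, ← tsum_mul_left]
  exact (Complex.hasSum_ofReal.1 h).tsum_eq.symm

/-- `poissonFactor` is the constant Fourier term; every other term has modulus at most its value at
the origin, and those values add up to the right-hand side. -/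
theorem abs_thetaSum_sub_le (B : (ι → ℝ) ≃L[ℝ] E) {a : ℝ} (ha : 0 < a) (x : ι → ℝ) :
    |thetaSum B a x - poissonFactor B a| ≤ poissonFactor B a * (dualSum B a - 1) := by
  classical
  have h0 : dualVec B 0 = 0 := by
    rw [dualVec]; simp
  have h1 := (hasSum_thetaSum B ha x).sub (hasSum_ite_eq (0 : ι → ℤ) (poissonFactor B a : ℂ))
  have h2 := (((summable_dualSum B ha).hasSum).sub (hasSum_ite_eq (0 : ι → ℤ) (1 : ℝ))).mul_left
    (poissonFactor B a)
  rw [← norm_eq_abs, ← Complex.norm_real, Complex.ofReal_sub, ← h1.tsum_eq]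
  refine tsum_of_norm_bounded h2 fun j => ?_
  by_cases hj : j = 0
  · subst hj
    simp [h0, UnitAddTorus.mFourier_zero]
  · rw [if_neg hj, if_neg hj, sub_zero, sub_zero, norm_mul, Complex.norm_real,
      norm_of_nonneg (mul_pos (poissonFactor_pos B ha) (exp_pos _)).le]
    refine mul_le_of_le_one_right (mul_pos (poissonFactor_pos B ha) (exp_pos _)).le ?_
    exact ((UnitAddTorus.mFourier j).norm_coe_le_norm _).trans UnitAddTorus.mFourier_norm.le

theorem thetaSum_le_zero (B : (ι → ℝ) ≃L[ℝ] E) {a : ℝ} (ha : 0 < a) (x : ι → ℝ) :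
    thetaSum B a x ≤ thetaSum B a 0 := by
  have h := (abs_le.1 (abs_thetaSum_sub_le B ha x)).2
  rw [thetaSum_zero B ha]
  linarith

/-! ### Tail estimates and the transference bound. -/

-- Half of the exponent is spent on the distance bound, the other half is kept for summation.
-- `dualSum_le_add` plays the same trick on the dual side.
omit [FiniteDimensional ℝ E] [MeasurableSpace E] [BorelSpace E] in
theorem thetaSum_le_of_forall_le (B : (ι → ℝ) ≃L[ℝ] E) {a : ℝ} (ha : 0 < a) {x : ι → ℝ} {R : ℝ}
    (h : ∀ k : ι → ℤ, R ≤ ‖B (x + intVec k)‖ ^ 2) :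
    thetaSum B a x ≤ rexp (-(a / 2 * R)) * thetaSum B (a / 2) x := by
  rw [thetaSum, thetaSum, ← tsum_mul_left]
  refine (summable_thetaSum B ha x).tsum_le_tsum (fun k => ?_)
    ((summable_thetaSum B (half_pos ha) x).mul_left _)
  rw [← exp_add]
  refine exp_le_exp.2 ?_
  nlinarith [h k]

omit [MeasurableSpace E] [BorelSpace E] in
theorem dualSum_mono (B : (ι → ℝ) ≃L[ℝ] E) {a a' : ℝ} (ha : 0 < a) (h : a ≤ a') :
    dualSum B a ≤ dualSum B a' := by
  refine (summable_dualSum B ha).tsum_le_tsum (fun j => exp_le_exp.2 ?_)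
    (summable_dualSum B (ha.trans_le h))
  gcongr

omit [FiniteDimensional ℝ E] [MeasurableSpace E] [BorelSpace E] in
theorem thetaSum_zero_anti (B : (ι → ℝ) ≃L[ℝ] E) {a a' : ℝ} (ha : 0 < a) (h : a ≤ a') :
    thetaSum B a' 0 ≤ thetaSum B a 0 := by
  refine (summable_thetaSum B (ha.trans_le h) 0).tsum_le_tsum (fun j => exp_le_exp.2 ?_)
    (summable_thetaSum B ha 0)
  gcongr

omit [MeasurableSpace E] [BorelSpace E] in
theorem dualSum_le_add (B : (ι → ℝ) ≃L[ℝ] E) {a : ℝ} (ha : 0 < a) {r : ℝ}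
    (h : ∀ j : ι → ℤ, j ≠ 0 → r ≤ ‖dualVec B j‖ ^ 2) :
    dualSum B a ≤ 1 + rexp (-(π ^ 2 / (2 * a) * r)) * dualSum B (2 * a) := by
  classical
  have h2 := (hasSum_ite_eq (0 : ι → ℤ) (1 : ℝ)).add
    ((summable_dualSum B (mul_pos two_pos ha)).hasSum.mul_left (rexp (-(π ^ 2 / (2 * a) * r))))
  refine ((summable_dualSum B ha).tsum_le_tsum (fun j => ?_) h2.summable).trans_eq h2.tsum_eq
  rw [← exp_add]
  by_cases hj : j = 0
  · subst hj
    have h0 : dualVec B 0 = 0 := by rw [dualVec]; simp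
    simpa [h0] using (exp_pos _).le
  · rw [if_neg hj, zero_add]
    refine exp_le_exp.2 ?_
    have h3 := mul_le_mul_of_nonneg_left (h j hj) (by positivity : 0 ≤ π ^ 2 / (2 * a))
    have h4 : π ^ 2 / a = π ^ 2 / (2 * a) + π ^ 2 / (2 * a) := by field_simp; ring
    rw [h4, add_mul]
    linarith

/-- A transference bound: if all nonzero dual vectors have squared length at least `r`,
then the squared covering radius is at most `m ^ 2 / (π ^ 2 * r)`. -/
theorem exists_norm_sq_le (B : (ι → ℝ) ≃L[ℝ] E) (hm : 8 ≤ Module.finrank ℝ E) {r : ℝ} (hr : 0 < r)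
    (h : ∀ j : ι → ℤ, j ≠ 0 → r ≤ ‖dualVec B j‖ ^ 2) (x : ι → ℝ) :
    ∃ k : ι → ℤ, ‖B (x + intVec k)‖ ^ 2 ≤ (Module.finrank ℝ E : ℝ) ^ 2 / (π ^ 2 * r) := by
  by_contra! hx
  set m : ℝ := (Module.finrank ℝ E : ℝ) with hmdef
  have hm8 : (8 : ℝ) ≤ m := by rw [hmdef]; exact_mod_cast hm
  -- With R = m²/(π² r), this choice balances the two tails: aR/2 and π² r/(2a) both equal m/2.
  set a := π ^ 2 * r / m with hadef
  have ha : 0 < a := by positivity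
  set ε := (2 : ℝ) ^ (m / 2) * rexp (-(m / 2)) with hε
  have hε0 : 0 < ε := by positivity
  -- ε = (2/e)^(m/2) decreases in m and is below 1/3 from m = 8 on; this is the source of the
  -- hypothesis on the rank.
  have hε3 : 3 * ε < 1 := by
    have he := exp_one_gt_d9
    have h1 : ε = (2 / rexp 1) ^ (m / 2) := by
      rw [div_rpow (by norm_num) (exp_pos _).le, ← exp_mul, one_mul, hε, exp_neg, ← div_eq_mul_inv]
    have h2 : ε ≤ (2 / rexp 1) ^ (4 : ℝ) := by
      rw [h1]
      exact rpow_le_rpow_of_exponent_ge (by positivity)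
        (by rw [div_le_one (exp_pos _)]; linarith) (by linarith)
    have h3 : (2 / rexp 1) ^ (4 : ℝ) ≤ (2 / 2.7 : ℝ) ^ 4 := by
      rw [show (4 : ℝ) = (4 : ℕ) by norm_num, rpow_natCast]
      gcongr
      linarith
    have h4 : (2 / 2.7 : ℝ) ^ 4 < 1 / 3 := by norm_num
    linarith
  have hK := poissonFactor_pos B ha
  have hD1 : 1 ≤ dualSum B a := by
    have := (abs_nonneg _).trans (abs_thetaSum_sub_le B ha 0)
    nlinarith
  have h1 : thetaSum B a x ≤ ε * (poissonFactor B a * dualSum B a) := by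
    calc thetaSum B a x
        ≤ rexp (-(a / 2 * (m ^ 2 / (π ^ 2 * r)))) * thetaSum B (a / 2) x :=
          thetaSum_le_of_forall_le B ha fun k => (hx k).le
      _ ≤ rexp (-(a / 2 * (m ^ 2 / (π ^ 2 * r)))) * (poissonFactor B (a / 2) * dualSum B a) := by
          gcongr
          refine (thetaSum_le_zero B (half_pos ha) x).trans ?_
          rw [thetaSum_zero B (half_pos ha)]
          have := poissonFactor_pos B (half_pos ha)
          gcongr
          exact dualSum_mono B (half_pos ha) (by linarith)
      _ = _ := by
          rw [poissonFactor_half B ha, show a / 2 * (m ^ 2 / (π ^ 2 * r)) = m / 2 by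
            rw [hadef]; field_simp, hε]
          ring
  -- Doubling a shrinks the primal sum at 0; Poisson summation converts this into a bound on the
  -- growth of the dual sum.
  have h2 : dualSum B (2 * a) ≤ 2 ^ (m / 2) * dualSum B a := by
    have h3 := thetaSum_zero_anti B ha (show a ≤ 2 * a by linarith)
    have ha2 : 0 < 2 * a := by linarith
    have h4 := poissonFactor_half B ha2
    rw [show 2 * a / 2 = a by ring] at h4
    have := poissonFactor_pos B ha2
    rw [thetaSum_zero B ha, thetaSum_zero B ha2, h4] at h3
    refine le_of_mul_le_mul_left (h3.trans_eq ?_) this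
    ring
  have h3 : dualSum B a ≤ 1 + ε * dualSum B a := by
    refine (dualSum_le_add B ha h).trans ?_
    rw [show π ^ 2 / (2 * a) * r = m / 2 by rw [hadef]; field_simp]
    have := mul_le_mul_of_nonneg_left h2 (exp_pos (-(m / 2))).le
    rw [hε]
    linarith
  have h4 := (abs_le.1 (abs_thetaSum_sub_le B ha x)).1
  have h5 : poissonFactor B a * (2 - dualSum B a) ≤
      poissonFactor B a * (ε * dualSum B a) := by linarith
  have h6 := le_of_mul_le_mul_left h5 hK
  -- With D = `dualSum B a`: D ≤ 1 + εD and 2 - D ≤ εD give 2(1 - ε) ≤ 1 + ε, that is 1 ≤ 3ε.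
  nlinarith

end Poisson

/-! ### Gram–Schmidt vectors, initial lattices and covering radii. -/

section Lattice

variable {n : ℕ} {b : Fin n → EuclideanSpace ℝ (Fin n)}

/-- The real span of the first `i` vectors of the family. -/
def initialSpan (b : Fin n → EuclideanSpace ℝ (Fin n)) (i : ℕ) :
    Submodule ℝ (EuclideanSpace ℝ (Fin n)) :=
  Submodule.span ℝ (b '' {j | (j : ℕ) < i})

theorem span_initialLattice (b : Fin n → EuclideanSpace ℝ (Fin n)) (i : ℕ) :
    Submodule.span ℝ (initialLattice b i : Set (EuclideanSpace ℝ (Fin n))) = initialSpan b i :=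
  Submodule.span_span_of_tower ℤ ℝ _

theorem mem_initialSpan {i : ℕ} {j : Fin n} (h : (j : ℕ) < i) : b j ∈ initialSpan b i :=
  Submodule.subset_span ⟨j, h, rfl⟩

theorem mem_initialLattice {i : ℕ} {j : Fin n} (h : (j : ℕ) < i) : b j ∈ initialLattice b i :=
  Submodule.subset_span ⟨j, h, rfl⟩

theorem initialSpan_mono {i j : ℕ} (h : i ≤ j) : initialSpan b i ≤ initialSpan b j :=
  Submodule.span_mono (image_mono fun _ hk => lt_of_lt_of_le hk h)

theorem initialLattice_mono {i j : ℕ} (h : i ≤ j) : initialLattice b i ≤ initialLattice b j :=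
  Submodule.span_mono (image_mono fun _ hk => lt_of_lt_of_le hk h)

theorem initialLattice_le_latticeOf (i : ℕ) : initialLattice b i ≤ latticeOf b :=
  Submodule.span_mono (image_subset_range _ _)

theorem initialLattice_subset_initialSpan {i : ℕ} {x : EuclideanSpace ℝ (Fin n)}
    (hx : x ∈ initialLattice b i) : x ∈ initialSpan b i := by
  rw [← span_initialLattice]
  exact Submodule.subset_span hx

theorem initialSpan_val (j : Fin n) :
    initialSpan b j = Submodule.span ℝ (gsVec b '' Iio j) := by
  rw [gsVec, InnerProductSpace.span_gramSchmidt_Iio]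
  rfl

theorem gsVec_mem_initialSpan (j : Fin n) : gsVec b j ∈ initialSpan b (j + 1) := by
  have h := InnerProductSpace.gramSchmidt_mem_span ℝ b (le_refl j)
  refine Submodule.span_mono (image_mono fun l hl => ?_) h
  exact Nat.lt_succ_of_le hl

theorem inner_gsVec_eq_zero (j : Fin n) {x : EuclideanSpace ℝ (Fin n)}
    (hx : x ∈ initialSpan b j) : inner ℝ x (gsVec b j) = 0 := by
  rw [initialSpan_val] at hx
  induction hx using Submodule.span_induction with
  | mem x h =>
    obtain ⟨l, hl, rfl⟩ := h
    exact InnerProductSpace.gramSchmidt_orthogonal ℝ b (ne_of_lt hl)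
  | zero => simp
  | add x y _ _ hx hy => rw [inner_add_left, hx, hy, add_zero]
  | smul a x _ hx => rw [real_inner_smul_left, hx, mul_zero]

theorem sub_gsVec_mem_initialSpan (j : Fin n) : b j - gsVec b j ∈ initialSpan b j := by
  rw [initialSpan_val, gsVec, InnerProductSpace.gramSchmidt_def, sub_sub_cancel]
  refine Submodule.sum_mem _ fun l hl => ?_
  refine Submodule.span_mono ?_ (Submodule.starProjection_apply_mem _ _)
  rintro _ rfl
  exact ⟨l, Finset.mem_Iio.1 hl, rfl⟩

theorem gsVec_ne_zero (hb : LinearIndependent ℝ b) (j : Fin n) : gsVec b j ≠ 0 :=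
  InnerProductSpace.gramSchmidt_ne_zero j hb

theorem exists_eq_add_smul_gsVec (j : Fin n) {t : EuclideanSpace ℝ (Fin n)}
    (ht : t ∈ initialSpan b (j + 1)) :
    ∃ t' ∈ initialSpan b j, ∃ a : ℝ, t = t' + a • gsVec b j := by
  induction ht using Submodule.span_induction with
  | mem x h =>
    obtain ⟨l, hl, rfl⟩ := h
    rcases Nat.lt_succ_iff_lt_or_eq.1 hl with hl | hl
    · exact ⟨b l, mem_initialSpan hl, 0, by simp⟩
    · obtain rfl : l = j := Fin.ext hl
      exact ⟨_, sub_gsVec_mem_initialSpan l, 1, by simp⟩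
  | zero => exact ⟨0, zero_mem _, 0, by simp⟩
  | add x y _ _ hx hy =>
    obtain ⟨x', hx', a, rfl⟩ := hx
    obtain ⟨y', hy', c, rfl⟩ := hy
    exact ⟨x' + y', add_mem hx' hy', a + c, by module⟩
  | smul c x _ hx =>
    obtain ⟨x', hx', a, rfl⟩ := hx
    exact ⟨c • x', Submodule.smul_mem _ _ hx', c * a, by module⟩

theorem norm_add_smul_gsVec_sq (j : Fin n) {t : EuclideanSpace ℝ (Fin n)}
    (ht : t ∈ initialSpan b j) (a : ℝ) :
    ‖t + a • gsVec b j‖ ^ 2 = ‖t‖ ^ 2 + a ^ 2 * ‖gsVec b j‖ ^ 2 := by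
  rw [norm_add_sq_real, real_inner_smul_right, inner_gsVec_eq_zero j ht, norm_smul, mul_pow,
    norm_eq_abs, sq_abs]
  ring

/-- Babai's nearest plane step: choose the translate of span(b_1, …, b_{j-1}) by rounding, at
distance at most half of ‖b_j^*‖, then approximate inside it. -/
theorem infDist_sq_le_add (j : Fin n) {M : ℝ}
    (hM : ∀ t ∈ initialSpan b j, Metric.infDist t (initialLattice b j) ≤ M)
    {t : EuclideanSpace ℝ (Fin n)} (ht : t ∈ initialSpan b (j + 1)) :
    Metric.infDist t (initialLattice b (j + 1)) ^ 2 ≤ M ^ 2 + ‖gsVec b j‖ ^ 2 / 4 := by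
  obtain ⟨t', ht', a, rfl⟩ := exists_eq_add_smul_gsVec j ht
  set D := Metric.infDist (t' + a • gsVec b j) (initialLattice b (j + 1))
  set s := t' - (round a : ℝ) • (b j - gsVec b j) with hs
  have hs' : s ∈ initialSpan b j :=
    sub_mem ht' (Submodule.smul_mem _ _ (sub_gsVec_mem_initialSpan j))
  -- The real square root vanishes on negative arguments, so no case distinction on D is needed.
  have h1 : √(D ^ 2 - ‖gsVec b j‖ ^ 2 / 4) ≤ Metric.infDist s (initialLattice b j) := by
    refine (Metric.le_infDist ⟨0, zero_mem _⟩).2 fun x hx => ?_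
    rw [dist_eq_norm]
    refine Real.sqrt_le_iff.2 ⟨norm_nonneg _, ?_⟩
    have h2 : x + round a • b j ∈ initialLattice b (j + 1) :=
      add_mem (initialLattice_mono (Nat.le_succ _) hx)
        (Submodule.smul_mem _ _ (mem_initialLattice (Nat.lt_succ_self _)))
    have h3 : D ≤ ‖(s - x) + (a - round a) • gsVec b j‖ := by
      refine (Metric.infDist_le_dist_of_mem h2).trans_eq ?_
      rw [dist_eq_norm, hs, ← Int.cast_smul_eq_zsmul ℝ]
      congr 1
      module
    have h4 := pow_le_pow_left₀ Metric.infDist_nonneg h3 2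
    rw [norm_add_smul_gsVec_sq j (sub_mem hs' (initialLattice_subset_initialSpan hx))] at h4
    have h5 : (a - round a) ^ 2 ≤ 1 / 4 := by
      rw [← sq_abs]
      nlinarith [abs_sub_round a, abs_nonneg (a - round a)]
    nlinarith [mul_le_mul_of_nonneg_right h5 (sq_nonneg ‖gsVec b j‖)]
  have h2 := (Real.sqrt_le_iff.1 (h1.trans (hM s hs'))).2
  linarith

theorem initialSpan_zero : initialSpan b 0 = ⊥ := by simp [initialSpan]

/-- Boundedness makes the supremum in `coveringRadius` genuine: the real `sSup` of an unbounded set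
is 0. -/
theorem exists_infDist_le (b : Fin n → EuclideanSpace ℝ (Fin n)) (i : ℕ) (hi : i ≤ n) :
    ∃ M, ∀ t ∈ initialSpan b i, Metric.infDist t (initialLattice b i) ≤ M := by
  induction i with
  | zero =>
    refine ⟨0, fun t ht => ?_⟩
    rw [initialSpan_zero, Submodule.mem_bot] at ht
    rw [ht, Metric.infDist_zero_of_mem (zero_mem _)]
  | succ i ih =>
    obtain ⟨M, hM⟩ := ih (Nat.le_of_succ_le hi)
    exact ⟨_, fun t ht => Real.le_sqrt_of_sq_le (infDist_sq_le_add ⟨i, hi⟩ hM ht)⟩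

theorem infDist_le_coveringRadius {i : ℕ} (hi : i ≤ n) {t : EuclideanSpace ℝ (Fin n)}
    (ht : t ∈ initialSpan b i) :
    Metric.infDist t (initialLattice b i) ≤ coveringRadius (initialLattice b i) := by
  obtain ⟨M, hM⟩ := exists_infDist_le b i hi
  rw [coveringRadius, span_initialLattice]
  refine le_csSup ⟨M, ?_⟩ ⟨t, ht, rfl⟩
  rintro _ ⟨s, hs, rfl⟩
  exact hM s hs

theorem coveringRadius_nonneg {m : ℕ} (L : Submodule ℤ (EuclideanSpace ℝ (Fin m))) :
    0 ≤ coveringRadius L :=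
  Real.sSup_nonneg <| by
    rintro _ ⟨s, _, rfl⟩
    exact Metric.infDist_nonneg

theorem coveringRadius_sq_le {i : ℕ} {R : ℝ}
    (h : ∀ t ∈ initialSpan b i, Metric.infDist t (initialLattice b i) ^ 2 ≤ R) :
    coveringRadius (initialLattice b i) ^ 2 ≤ R := by
  have hR : 0 ≤ R := (sq_nonneg _).trans (h 0 (zero_mem _))
  refine (Real.le_sqrt (coveringRadius_nonneg _) hR).1 ?_
  rw [coveringRadius, span_initialLattice]
  refine csSup_le (Set.Nonempty.image _ ⟨0, zero_mem _⟩) ?_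
  rintro _ ⟨s, hs, rfl⟩
  exact Real.le_sqrt_of_sq_le (h s hs)

theorem coveringRadius_succ_sq_le (b : Fin n → EuclideanSpace ℝ (Fin n)) (j : Fin n) :
    coveringRadius (initialLattice b (j + 1)) ^ 2 ≤
      coveringRadius (initialLattice b j) ^ 2 + ‖gsVec b j‖ ^ 2 / 4 :=
  coveringRadius_sq_le fun _ ht =>
    infDist_sq_le_add j (fun _ hs => infDist_le_coveringRadius j.2.le hs) ht

theorem coveringRadius_zero : coveringRadius (initialLattice b 0) ^ 2 ≤ 0 :=
  coveringRadius_sq_le fun t ht => by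
    rw [initialSpan_zero, Submodule.mem_bot] at ht
    rw [ht, Metric.infDist_zero_of_mem (zero_mem _), sq, mul_zero]

/-! ### The consequence of dual HKZ reduction. -/

/-- Dual vectors of the initial lattices are at least as long as the inverse of the norm of the last
Gram-Schmidt vector. -/
def HasLongDuals (b : Fin n → EuclideanSpace ℝ (Fin n)) : Prop :=
  ∀ (j : Fin n) (y : EuclideanSpace ℝ (Fin n)), y ∈ initialSpan b (j + 1) → y ≠ 0 →
    (∀ l ≤ j, ∃ k : ℤ, inner ℝ y (b l) = k) → 1 ≤ ‖gsVec b j‖ * ‖y‖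

/-- With l the reversed index of j, such a y is a nonzero vector of the projected lattice whose
shortest length is ‖d_l^*‖, while ⟨d_l^*, b_j^*⟩ = 1 gives 1 ≤ ‖d_l^*‖ ‖b_j^*‖. -/
theorem IsDualHKZ.hasLongDuals (hb : LinearIndependent ℝ b) (h : IsDualHKZ b) :
    HasLongDuals b := by
  obtain ⟨d, hd, hk⟩ := h
  intro j y hy hy0 hint
  have hinner : ∀ l i, inner ℝ (d l) (b i) = if l = Fin.rev i then (1 : ℝ) else 0 := hd.inner_eq
  have hspan : Submodule.span ℝ (range b) = ⊤ :=
    hb.span_eq_top_of_card_eq_finrank' (by simp)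
  have hext : ∀ z : EuclideanSpace ℝ (Fin n), (∀ i, inner ℝ z (b i) = 0) → z = 0 := by
    intro z hz
    have : z ∈ (Submodule.span ℝ (range b))ᗮ := by
      rw [Submodule.mem_orthogonal']
      intro u hu
      induction hu using Submodule.span_induction with
      | mem x h => obtain ⟨l, rfl⟩ := h; exact hz l
      | zero => simp
      | add x y _ _ hx hy => rw [inner_add_right, hx, hy, add_zero]
      | smul a x _ hx => rw [real_inner_smul_right, hx, mul_zero]
    rwa [hspan, Submodule.top_orthogonal_eq_bot, Submodule.mem_bot] at this
  set l := Fin.rev j with hl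
  set W := Submodule.span ℝ (d '' {i | i < l}) with hW
  have horth : ∀ u ∈ initialSpan b (j + 1), u ∈ Wᗮ := by
    intro u hu
    rw [Submodule.mem_orthogonal]
    intro w hw
    induction hw using Submodule.span_induction with
    | mem x h =>
      obtain ⟨i, hi, rfl⟩ := h
      induction hu using Submodule.span_induction with
      | mem x h =>
        obtain ⟨k, hk, rfl⟩ := h
        rw [hinner, if_neg]
        rintro rfl
        exact absurd (Fin.rev_lt_rev.1 (hi : Fin.rev k < Fin.rev j)) (not_lt.2 (Nat.lt_succ_iff.1 hk))
      | zero => simp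
      | add x y _ _ hx hy => rw [inner_add_right, hx, hy, add_zero]
      | smul a x _ hx => rw [real_inner_smul_right, hx, mul_zero]
    | zero => simp
    | add x y _ _ hx hy => rw [inner_add_left, hx, hy, add_zero]
    | smul a x _ hx => rw [real_inner_smul_left, hx, mul_zero]
  have hy1 : y = ∑ i, (inner ℝ y (b i) : ℝ) • d (Fin.rev i) := by
    refine sub_eq_zero.1 (hext _ fun i => ?_)
    rw [inner_sub_left, sum_inner, Finset.sum_eq_single i]
    · rw [real_inner_smul_left, hinner, if_pos rfl, mul_one, sub_self]
    · intro k _ hki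
      rw [real_inner_smul_left, hinner, if_neg (fun h => hki (Fin.rev_injective h)), mul_zero]
    · simp
  choose! c hc using hint
  -- The expansion of y in the dual basis has integer coefficients at the indices up to j; the
  -- remaining terms lie in W and are killed by the projection, so they may be dropped.
  have hmem : y ∈ projectedLattice d l := by
    refine ⟨∑ i ∈ Finset.univ.filter (· ≤ j), c i • d (Fin.rev i), ?_, ?_⟩
    · exact Submodule.sum_mem _ fun i _ =>
        Submodule.smul_mem _ _ (Submodule.subset_span ⟨_, rfl⟩)
    · change Wᗮ.starProjection _ = y
      have hyW : Wᗮ.starProjection y = y :=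
        Submodule.starProjection_eq_self_iff.2 (horth y hy)
      conv_rhs => rw [← hyW, hy1]
      rw [← sub_eq_zero, ← map_sub, Submodule.starProjection_apply_eq_zero_iff]
      apply Submodule.le_orthogonal_orthogonal
      rw [← Finset.sum_filter_add_sum_filter_not Finset.univ (· ≤ j), ← sub_sub,
        ← Finset.sum_sub_distrib, Finset.sum_eq_zero, zero_sub]
      · refine neg_mem (Submodule.sum_mem _ fun i hi => Submodule.smul_mem _ _ ?_)
        refine Submodule.subset_span ⟨_, ?_, rfl⟩
        exact Fin.rev_lt_rev.2 (not_le.1 (Finset.mem_filter.1 hi).2)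
      · intro i hi
        rw [hc i (Finset.mem_filter.1 hi).2, Int.cast_smul_eq_zsmul, sub_self]
  have h1 : ‖gsVec d l‖ ≤ ‖y‖ := by
    rw [hk.norm_gsVec l]
    refine csInf_le ⟨0, ?_⟩ ⟨y, hmem, hy0, rfl⟩
    rintro _ ⟨_, _, _, rfl⟩
    exact norm_nonneg _
  have h2 : inner ℝ (gsVec d l) (gsVec b j) = (1 : ℝ) := by
    have h3 : gsVec b j ∈ Wᗮ := horth _ (gsVec_mem_initialSpan j)
    have h4 : inner ℝ (d l - gsVec d l) (gsVec b j) = (0 : ℝ) :=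
      Submodule.mem_orthogonal _ _ |>.1 h3 _ (sub_gsVec_mem_initialSpan l)
    have h5 : inner ℝ (d l) (b j - gsVec b j) = (0 : ℝ) := by
      have h6 := sub_gsVec_mem_initialSpan (b := b) j
      generalize b j - gsVec b j = u at h6
      induction h6 using Submodule.span_induction with
      | mem x h =>
        obtain ⟨k, hk, rfl⟩ := h
        rw [hinner, if_neg]
        exact fun h => (ne_of_lt (hk : k < j)) (Fin.rev_injective h).symm
      | zero => simp
      | add x y _ _ hx hy => rw [inner_add_right, hx, hy, add_zero]
      | smul a x _ hx => rw [real_inner_smul_right, hx, mul_zero]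
    rw [inner_sub_left] at h4
    rw [inner_sub_right, hinner, if_pos rfl] at h5
    linarith
  have h3 := real_inner_le_norm (gsVec d l) (gsVec b j)
  rw [h2] at h3
  nlinarith [norm_nonneg (gsVec b j)]

end Lattice

/-! ### Bounds on covering radii by the Gram–Schmidt norms. -/

section DualHKZ

variable {n : ℕ} {b : Fin n → EuclideanSpace ℝ (Fin n)}

theorem inner_gsVec_self (j : Fin n) : inner ℝ (gsVec b j) (b j) = ‖gsVec b j‖ ^ 2 := by
  have h := inner_gsVec_eq_zero j (sub_gsVec_mem_initialSpan (b := b) j)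
  rw [inner_sub_left, real_inner_self_eq_norm_sq, real_inner_comm] at h
  linarith

theorem inner_gsVec_of_lt {j l : Fin n} (h : l < j) : inner ℝ (gsVec b j) (b l) = (0 : ℝ) := by
  rw [real_inner_comm]
  exact inner_gsVec_eq_zero j (mem_initialSpan h)

theorem HasLongDuals.norm_gsVec_sq_le (hb : LinearIndependent ℝ b) (h : HasLongDuals b) {j : ℕ}
    (hj : j + 1 < n) :
    ‖gsVec b ⟨j, by omega⟩‖ ^ 2 ≤ 4 / 3 * ‖gsVec b ⟨j + 1, hj⟩‖ ^ 2 := by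
  set p : Fin n := ⟨j, by omega⟩ with hp
  set q : Fin n := ⟨j + 1, hj⟩ with hq
  have hpq : p < q := Nat.lt_succ_self j
  have hu : 0 < ‖gsVec b p‖ ^ 2 := by have := norm_pos_iff.2 (gsVec_ne_zero hb p); positivity
  have hv : 0 < ‖gsVec b q‖ ^ 2 := by have := norm_pos_iff.2 (gsVec_ne_zero hb q); positivity
  set u := ‖gsVec b p‖ ^ 2 with hu'
  set v := ‖gsVec b q‖ ^ 2 with hv'
  set ν : ℝ := inner ℝ (gsVec b p) (b q) / u
  set a : ℝ := round ν - ν with ha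
  have hpm : gsVec b p ∈ initialSpan b q := gsVec_mem_initialSpan p
  -- Pairs to 1 with b_p, to ν + a = round ν with b_q, and to 0 with all earlier vectors. Since |a|
  -- ≤ 1/2, the bound 1 ≤ v‖y‖² yields v/u ≥ 3/4.
  set y := u⁻¹ • gsVec b p + (a / v) • gsVec b q with hy
  have hnorm : ‖y‖ ^ 2 = u⁻¹ + a ^ 2 / v := by
    rw [hy, norm_add_smul_gsVec_sq q (Submodule.smul_mem _ _ hpm), norm_smul, mul_pow, norm_eq_abs,
      sq_abs, ← hu', ← hv']
    field_simp
  have hy0 : y ≠ 0 := by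
    intro h0
    rw [h0, norm_zero] at hnorm
    have : 0 < u⁻¹ := by positivity
    have : 0 ≤ a ^ 2 / v := by positivity
    nlinarith
  have h1 := h q y (add_mem (Submodule.smul_mem _ _ (initialSpan_mono (Nat.le_succ _) hpm))
    (Submodule.smul_mem _ _ (gsVec_mem_initialSpan q))) hy0 ?_
  · have h2 : 1 ≤ v * (u⁻¹ + a ^ 2 / v) := by
      rw [← hnorm, hv', ← mul_pow]
      exact one_le_pow₀ h1
    have h3 : a ^ 2 ≤ 1 / 4 := by
      have h4 := abs_sub_round ν
      rw [abs_sub_comm] at h4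
      rw [← sq_abs]
      nlinarith [abs_nonneg a]
    have h5 : v * (u⁻¹ + a ^ 2 / v) = v / u + a ^ 2 := by field_simp
    have h6 : 3 / 4 ≤ v / u := by linarith
    rw [le_div_iff₀ hu] at h6
    linarith
  · intro l hl
    rw [hy]
    simp only [inner_add_left, real_inner_smul_left]
    rcases lt_trichotomy l p with hlp | rfl | hlp
    · exact ⟨0, by rw [inner_gsVec_of_lt hlp, inner_gsVec_of_lt (hlp.trans hpq)]; simp⟩
    · refine ⟨1, ?_⟩
      rw [inner_gsVec_self, inner_gsVec_of_lt hpq, ← hu']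
      field_simp
      simp
    · obtain rfl : l = q := le_antisymm hl hlp
      refine ⟨round ν, ?_⟩
      rw [inner_gsVec_self, ← hv', div_mul_cancel₀ _ hv.ne', ha, inv_mul_eq_div]
      ring

theorem range_comp_castLE {i : ℕ} (hi : i ≤ n) :
    range (b ∘ Fin.castLE hi) = b '' {j | (j : ℕ) < i} := by
  rw [range_comp]
  congr 1
  ext j
  exact ⟨by rintro ⟨k, rfl⟩; exact k.2, fun h => ⟨⟨j, h⟩, rfl⟩⟩

/-- The transference bound with r = 1/‖b_j^*‖², applied inside the span of the initial vectors. -/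
theorem HasLongDuals.coveringRadius_sq_le_of_large (hb : LinearIndependent ℝ b)
    (h : HasLongDuals b) (j : Fin n) (hj : 8 ≤ (j : ℕ) + 1) :
    coveringRadius (initialLattice b (j + 1)) ^ 2 ≤
      ((j : ℝ) + 1) ^ 2 / π ^ 2 * ‖gsVec b j‖ ^ 2 := by
  have hjn : (j : ℕ) + 1 ≤ n := j.2
  have hβ : 0 < ‖gsVec b j‖ := norm_pos_iff.2 (gsVec_ne_zero hb j)
  have hli : LinearIndependent ℝ (b ∘ Fin.castLE hjn) :=
    hb.comp _ (Fin.castLE_injective hjn)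
  set V := Submodule.span ℝ (range (b ∘ Fin.castLE hjn)) with hV
  have hVeq : V = initialSpan b (j + 1) := by rw [hV, range_comp_castLE]; rfl
  set B : (Fin (j + 1) → ℝ) ≃L[ℝ] V := (Module.Basis.span hli).equivFun.symm.toContinuousLinearEquiv
  have hB : ∀ x, (B x : EuclideanSpace ℝ (Fin n)) = ∑ i, x i • b (Fin.castLE hjn i) := by
    intro x
    change (((Module.Basis.span hli).equivFun.symm x : V) : EuclideanSpace ℝ (Fin n)) = _
    rw [Module.Basis.equivFun_symm_apply, Submodule.coe_sum]
    refine Finset.sum_congr rfl fun i _ => ?_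
    rw [Submodule.coe_smul, Module.Basis.span_apply]
    rfl
  have hfin : Module.finrank ℝ V = j + 1 := by
    rw [Module.finrank_eq_card_basis (Module.Basis.span hli), Fintype.card_fin]
  borelize ↥V
  have hdual : ∀ k : Fin (j + 1) → ℤ, k ≠ 0 → (‖gsVec b j‖ ^ 2)⁻¹ ≤ ‖dualVec B k‖ ^ 2 := by
    intro k hk
    have hin : ∀ i : Fin (j + 1), inner ℝ ((dualVec B k : V) : EuclideanSpace ℝ (Fin n))
        (b (Fin.castLE hjn i)) = (k i : ℝ) := by
      intro i
      have h1 := inner_dualVec B k (Pi.single i 1)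
      rw [Submodule.coe_inner, hB] at h1
      simpa [Pi.single_apply] using h1
    have h1 := h j ((dualVec B k : V) : EuclideanSpace ℝ (Fin n))
      (hVeq.le (dualVec B k).2) ?_ ?_
    · rw [inv_le_iff_one_le_mul₀ (by positivity), mul_comm, ← mul_pow]
      exact one_le_pow₀ h1
    · intro h0
      refine hk (funext fun i => ?_)
      have h2 := hin i
      rw [h0, inner_zero_left] at h2
      exact_mod_cast h2.symm
    · intro l hl
      exact ⟨k ⟨l, Nat.lt_succ_of_le hl⟩, hin ⟨l, Nat.lt_succ_of_le hl⟩⟩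
  refine coveringRadius_sq_le fun t ht => ?_
  rw [← hVeq] at ht
  obtain ⟨k, hk⟩ := exists_norm_sq_le B (hfin ▸ hj) (by positivity) hdual (B.symm ⟨t, ht⟩)
  rw [hfin] at hk
  have hmem : -(B (intVec k) : EuclideanSpace ℝ (Fin n)) ∈ initialLattice b (j + 1) := by
    rw [hB]
    refine neg_mem (Submodule.sum_mem _ fun i _ => ?_)
    rw [intVec, Int.cast_smul_eq_zsmul]
    exact Submodule.smul_mem _ _ (mem_initialLattice i.2)
  have h1 := Metric.infDist_le_dist_of_mem (x := t) hmem
  rw [dist_eq_norm, sub_neg_eq_add] at h1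
  have h2 : ‖B (B.symm ⟨t, ht⟩ + intVec k)‖ = ‖t + B (intVec k)‖ := by
    rw [map_add, B.apply_symm_apply]; rfl
  rw [h2] at hk
  refine (pow_le_pow_left₀ Metric.infDist_nonneg h1 2).trans (hk.trans_eq ?_)
  push_cast
  field_simp

/-- The constant is (1/4) ∑_{k ≤ j} (4/3)^k: every rounding step costs a quarter of a squared
Gram–Schmidt norm, and those norms grow by at most 4/3 going backwards. -/
theorem HasLongDuals.coveringRadius_sq_le_geom (hb : LinearIndependent ℝ b)
    (h : HasLongDuals b) (j : ℕ) (hj : j < n) :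
    coveringRadius (initialLattice b (j + 1)) ^ 2 ≤
      3 / 4 * ((4 / 3) ^ (j + 1) - 1) * ‖gsVec b ⟨j, hj⟩‖ ^ 2 := by
  induction j with
  | zero =>
    have h1 := coveringRadius_succ_sq_le b ⟨0, hj⟩
    have h2 := coveringRadius_zero (b := b)
    simp only at h1
    norm_num
    linarith
  | succ j ih =>
    have h1 := coveringRadius_succ_sq_le b ⟨j + 1, hj⟩
    have h2 := ih (by omega)
    have h3 := h.norm_gsVec_sq_le hb hj
    have h4 : (1 : ℝ) ≤ (4 / 3) ^ (j + 1) := one_le_pow₀ (by norm_num)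
    have h5 := mul_le_mul_of_nonneg_left h3
      (by linarith : (0 : ℝ) ≤ 3 / 4 * ((4 / 3) ^ (j + 1) - 1))
    simp only at h1
    rw [pow_succ _ (j + 1)]
    linarith

theorem HasLongDuals.coveringRadius_sq_le (hb : LinearIndependent ℝ b)
    (h : HasLongDuals b) (j : ℕ) (hj : j + 1 < n) :
    coveringRadius (initialLattice b (j + 1)) ^ 2 ≤
      (((j : ℝ) + 2) ^ 2 / 4 - 1 / 4) * ‖gsVec b ⟨j + 1, hj⟩‖ ^ 2 := by
  have h1 := h.norm_gsVec_sq_le hb hj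
  have h0 := sq_nonneg ‖gsVec b ⟨j + 1, hj⟩‖
  -- The geometric bound is exponential in the rank j + 1, so it serves only small ranks; from rank
  -- 8 on transference applies, and π > 3 leaves enough room for the factor 4/3.
  rcases lt_or_ge j 7 with hj7 | hj7
  · have h2 := h.coveringRadius_sq_le_geom hb j (by omega)
    have h3 : (4 / 3) * (3 / 4 * ((4 / 3) ^ (j + 1) - 1)) ≤ ((j : ℝ) + 2) ^ 2 / 4 - 1 / 4 := by
      interval_cases j <;> norm_num
    have h4 : (1 : ℝ) ≤ (4 / 3) ^ (j + 1) := one_le_pow₀ (by norm_num)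
    have h5 := mul_le_mul_of_nonneg_left h1
      (by linarith : (0 : ℝ) ≤ 3 / 4 * ((4 / 3) ^ (j + 1) - 1))
    have h6 := mul_le_mul_of_nonneg_right h3 h0
    linarith
  · have h2 := h.coveringRadius_sq_le_of_large hb ⟨j, by omega⟩ (by simp only; omega)
    simp only at h2
    have h3 : ((j : ℝ) + 1) ^ 2 / π ^ 2 ≤ ((j : ℝ) + 1) ^ 2 / 9 := by
      gcongr
      nlinarith [pi_gt_three]
    have h4 := mul_le_mul h3 h1 (sq_nonneg _) (by positivity)
    have h5 : ((j : ℝ) + 1) ^ 2 / 9 * (4 / 3) ≤ ((j : ℝ) + 2) ^ 2 / 4 - 1 / 4 := by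
      nlinarith [(Nat.cast_nonneg j : (0 : ℝ) ≤ j)]
    have h6 := mul_le_mul_of_nonneg_right h5 h0
    linarith

/-! ### Errors of closest vectors. -/

theorem partialError_eq_sum {err : EuclideanSpace ℝ (Fin n)} {e : Fin n → ℝ}
    (he : err = ∑ j, e j • gsVec b j) (i : ℕ) :
    partialError b err e i =
      ∑ j ∈ Finset.univ.filter (fun j : Fin n => (j : ℕ) < i), e j • gsVec b j := by
  rw [partialError, he, sub_eq_iff_eq_add,
    ← Finset.sum_filter_add_sum_filter_not Finset.univ (fun j : Fin n => (j : ℕ) < i)]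
  simp only [not_lt, Nat.lt_succ_iff]

theorem partialError_mem {err : EuclideanSpace ℝ (Fin n)} {e : Fin n → ℝ}
    (he : err = ∑ j, e j • gsVec b j) (i : ℕ) : partialError b err e i ∈ initialSpan b i := by
  rw [partialError_eq_sum he]
  refine Submodule.sum_mem _ fun j hj => Submodule.smul_mem _ _ ?_
  exact initialSpan_mono (Finset.mem_filter.1 hj).2 (gsVec_mem_initialSpan j)

theorem partialError_succ {err : EuclideanSpace ℝ (Fin n)} {e : Fin n → ℝ}
    (he : err = ∑ j, e j • gsVec b j) (j : Fin n) :
    partialError b err e (j + 1) = partialError b err e j + e j • gsVec b j := by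
  rw [partialError_eq_sum he, partialError_eq_sum he, add_comm (Finset.sum _ _), 
    ← Finset.sum_insert (f := fun l => e l • gsVec b l) (by simp)]
  congr 1
  ext l
  simp only [Finset.mem_filter, Finset.mem_univ, true_and, Finset.mem_insert, Fin.ext_iff]
  omega

/-- Moving v by a vector w of the initial lattice changes only the component of the error in
span(b_1, …, b_i). Hence 0 is a closest vector to e^(i) in that lattice. -/
theorem norm_partialError_le {t v : EuclideanSpace ℝ (Fin n)} {e : Fin n → ℝ}
    (hv : IsClosestVector (latticeOf b) t v) (he : t - v = ∑ j, e j • gsVec b j) {i : ℕ}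
    (hi : i ≤ n) : ‖partialError b (t - v) e i‖ ≤ coveringRadius (initialLattice b i) := by
  refine le_trans ?_ (infDist_le_coveringRadius hi (partialError_mem he i))
  refine (Metric.le_infDist ⟨0, zero_mem _⟩).2 fun w hw => ?_
  rw [dist_eq_norm]
  set p := partialError b (t - v) e i with hp
  have horth : ∀ u ∈ initialSpan b i, inner ℝ u (t - v - p) = (0 : ℝ) := by
    intro u hu
    rw [hp, partialError, sub_sub_cancel, inner_sum]
    refine Finset.sum_eq_zero fun j hj => ?_
    rw [real_inner_smul_right, inner_gsVec_eq_zero j, mul_zero]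
    exact initialSpan_mono (Nat.lt_succ_iff.1 (Finset.mem_filter.1 hj).2) hu
  have hpm : p ∈ initialSpan b i := partialError_mem he i
  have hpy : ∀ u ∈ initialSpan b i, ‖u + (t - v - p)‖ ^ 2 = ‖u‖ ^ 2 + ‖t - v - p‖ ^ 2 := by
    intro u hu
    rw [norm_add_sq_real, horth u hu]
    ring
  have h1 := hpy p hpm
  have h2 := hpy (p - w) (sub_mem hpm (initialLattice_subset_initialSpan hw))
  have h3 := hv.2 (v + w) (add_mem hv.1 (initialLattice_le_latticeOf i hw))
  have h4 := pow_le_pow_left₀ (norm_nonneg _) h3 2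
  rw [norm_sub_rev v t, norm_sub_rev (v + w) t] at h4
  rw [show p + (t - v - p) = t - v by abel] at h1
  rw [show p - w + (t - v - p) = t - (v + w) by abel] at h2
  refine le_of_sq_le_sq ?_ (norm_nonneg _)
  linarith

theorem HasLongDuals.coveringRadius_sq_sub_le (hb : LinearIndependent ℝ b) (h : HasLongDuals b)
    (j : ℕ) (hj : j + 1 < n) {c : ℝ} (hc : 1 / 4 ≤ c ^ 2) :
    coveringRadius (initialLattice b (j + 2)) ^ 2 - c ^ 2 * ‖gsVec b ⟨j + 1, hj⟩‖ ^ 2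
      ≤ Asq (j + 2) c * coveringRadius (initialLattice b (j + 1)) ^ 2 := by
  have h1 := coveringRadius_succ_sq_le b ⟨j + 1, hj⟩
  have h2 := h.coveringRadius_sq_le hb j hj
  have hD : 0 < ((j : ℝ) + 2) ^ 2 / 4 - 1 / 4 := by
    nlinarith [(Nat.cast_nonneg j : (0 : ℝ) ≤ j)]
  have h3 : Asq (j + 2) c = 1 - (c ^ 2 - 1 / 4) / (((j : ℝ) + 2) ^ 2 / 4 - 1 / 4) := by
    rw [Asq]
    push_cast
    rw [eq_sub_iff_add_eq, ← add_div, div_eq_one_iff_eq hD.ne']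
    ring
  rw [h3, sub_mul, one_mul, div_mul_eq_mul_div]
  have h4 : (c ^ 2 - 1 / 4) * coveringRadius (initialLattice b (j + 1)) ^ 2 /
      (((j : ℝ) + 2) ^ 2 / 4 - 1 / 4) ≤ (c ^ 2 - 1 / 4) * ‖gsVec b ⟨j + 1, hj⟩‖ ^ 2 := by
    rw [div_le_iff₀ hD]
    have := mul_le_mul_of_nonneg_left h2 (by linarith : 0 ≤ c ^ 2 - 1 / 4)
    linarith
  simp only at h1
  linarith

theorem one_le_Asq (j : ℕ) {c : ℝ} (hc : c ^ 2 ≤ 1 / 4) : 1 ≤ Asq (j + 2) c := by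
  have hD : 0 < ((j : ℝ) + 2) ^ 2 / 4 - 1 / 4 := by
    nlinarith [(Nat.cast_nonneg j : (0 : ℝ) ≤ j)]
  rw [Asq]
  push_cast
  rw [one_le_div hD]
  linarith

end DualHKZ

theorem mainTheorem5 (n : ℕ) (b : Fin n → EuclideanSpace ℝ (Fin n))
    (hb : LinearIndependent ℝ b) (hHKZ : IsDualHKZ b)
    (i : ℕ) (hi : 2 ≤ i) (hin : i ≤ n) :
    (∀ c : ℝ, 1 / 4 ≤ c ^ 2 →
      coveringRadius (initialLattice b i) ^ 2 - c ^ 2 * ‖gsVec b ⟨i - 1, by omega⟩‖ ^ 2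
        ≤ Asq i c * coveringRadius (initialLattice b (i - 1)) ^ 2) ∧
    (∀ (t v : EuclideanSpace ℝ (Fin n)) (e : Fin n → ℝ),
      IsClosestVector (latticeOf b) t v →
      t - v = ∑ j : Fin n, e j • gsVec b j →
      ‖partialError b (t - v) e (i - 1)‖ ^ 2
        ≤ Asq i (e ⟨i - 1, by omega⟩) * coveringRadius (initialLattice b (i - 1)) ^ 2) := by
  have h := hHKZ.hasLongDuals hb
  obtain ⟨j, rfl⟩ := Nat.exists_eq_add_of_le' hi
  refine ⟨fun c hc => h.coveringRadius_sq_sub_le hb j hin hc, fun t v e hv he => ?_⟩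
  change ‖partialError b (t - v) e (j + 1)‖ ^ 2 ≤
    Asq (j + 2) (e ⟨j + 1, hin⟩) * coveringRadius (initialLattice b (j + 1)) ^ 2
  have h1 := pow_le_pow_left₀ (norm_nonneg _) (norm_partialError_le hv he (Nat.le_of_succ_le hin)) 2
  -- Part (a) is available only for c² ≥ 1/4; below that the factor is at least 1 and the bound on
  -- e^(i-1) is enough.
  rcases le_total (e ⟨j + 1, hin⟩ ^ 2) (1 / 4) with hc | hc
  · exact h1.trans (le_mul_of_one_le_left (sq_nonneg _) (one_le_Asq j hc))
  · refine le_trans ?_ (h.coveringRadius_sq_sub_le hb j hin hc)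
    have h2 := pow_le_pow_left₀ (norm_nonneg _) (norm_partialError_le hv he hin) 2
    have h3 := partialError_succ he ⟨j + 1, hin⟩
    simp only at h3
    rw [h3, norm_add_smul_gsVec_sq ⟨j + 1, hin⟩ (partialError_mem he (j + 1))] at h2
    linarith
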